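/- For $-\infty\le a<b\le+\infty$, an analytic curve $\gamma:(a,b)\to\overline{\mathbb C}=\mathbb C\cup\{\infty\}$ means a regular real-analytic curve in the Riemann sphere: about every $t_0\in(a,b)$ with $\gamma(t_0)\neq\infty$ (respectively $\gamma(t_0)=\infty$) the function $\gamma$ (respectively $1/\gamma$) is represented by a power series, and its derivative at $t_0$ is not zero. For $c=a$ (initial cluster set) and $c=b$ (terminal cluster set) put $$C(\gamma,c)=\{w\in\overline{\mathbb C}:\ \exists\, t_n\in(a,b),\ t_n\to c,\ \gamma(t_n)\to w\}.$$ An analytic change of parameter is an increasing real-analytic bijection between open intervals with nowhere vanishing derivative. An initial analytic extension of $\gamma$ is an analytic curve $\sigma:(L,R)\to\overline{\mathbb C}$ (with $-\infty\le L<R\le+\infty$) for which there are $A\in(L,R)$ and an analytic change of parameter $t$ from $(A,R)$ onto $(a,b)$ with $\sigma(s)=\gamma(t(s))$ for $A<s<R$; a terminal analytic extension is defined analogously, with $B\in(L,R)$ and a change of parameter $t$ from $(L,B)$ onto $(a,b)$. The curve $\gamma$ is maximal as an analytic curve if it has neither an initial nor a terminal analytic extension. **Theorem.** For any two continua (nonempty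 compact connected subsets) $K^-$ and $K^+$ of the Riemann sphere $\overline{\mathbb C}$ there exists an analytic curve $\gamma:(-\infty,+\infty)\to\mathbb C$ which is the restriction to the real line of an entire function, such that $$C(\gamma,-\infty)=K^-\quad\text{and}\quad C(\gamma,+\infty)=K^+ .$$ Moreover, the curve $\gamma$ is maximal as an analytic curve. -/

import Mathlib

open Filter Topology

/-- The Riemann sphere, as the one-point compactification of the complex plane. -/
abbrev RSphere : Type := OnePoint ℂ

/-- The inversion `w ↦ 1 / w` of the Riemann sphere, interchanging `0` and `∞`. -/
noncomputable def sphereInv : RSphere → RSphere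
  | none => ((0 : ℂ) : RSphere)
  | some z => open Classical in if z = 0 then OnePoint.infty else ((z⁻¹ : ℂ) : RSphere)

/-- A continuum of the Riemann sphere: a nonempty compact connected subset
(`IsConnected` includes non-emptiness). -/
def IsContinuum (K : Set RSphere) : Prop :=
  IsCompact K ∧ IsConnected K

/-- The open interval `(a, b)` of real numbers, for `a` and `b` in `[-∞, +∞]`. -/
def realIoo (a b : EReal) : Set ℝ :=
  {t : ℝ | a < (t : EReal) ∧ (t : EReal) < b}

/-- Near `t₀` the map `γ` takes finite values only and is given there by a function which has a
power series expansion about `t₀` and a nonzero derivative at `t₀`. -/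
def RegularAnalyticAt (γ : ℝ → RSphere) (t₀ : ℝ) : Prop :=
  ∃ g : ℝ → ℂ, AnalyticAt ℝ g t₀ ∧ deriv g t₀ ≠ 0 ∧ ∀ᶠ t in 𝓝 t₀, γ t = ((g t : ℂ) : RSphere)

/-- `γ : (a, b) → ℂ ∪ {∞}` is an analytic curve, that is, a regular real-analytic curve in the
Riemann sphere: at every parameter where `γ` is finite, `γ` itself is real-analytic with nonzero
derivative, and at every parameter where `γ = ∞`, the same holds for `1 / γ`.
Values of `γ` outside `(a, b)` are irrelevant. -/
structure IsAnalyticCurve (a b : EReal) (γ : ℝ → RSphere) : Prop where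
  lt : a < b
  finite : ∀ t₀ ∈ realIoo a b, γ t₀ ≠ OnePoint.infty → RegularAnalyticAt γ t₀
  infinite : ∀ t₀ ∈ realIoo a b, γ t₀ = OnePoint.infty →
    RegularAnalyticAt (fun t => sphereInv (γ t)) t₀

/-- The cluster set of `γ : (a, b) → ℂ ∪ {∞}` at `c` (used with `c = a` or `c = b`). -/
def curveClusterSet (a b : EReal) (γ : ℝ → RSphere) (c : EReal) : Set RSphere :=
  {w | ∃ t : ℕ → ℝ, (∀ n, t n ∈ realIoo a b) ∧
    Tendsto (fun n => (t n : EReal)) atTop (𝓝 c) ∧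
    Tendsto (fun n => γ (t n)) atTop (𝓝 w)}

/-- `C(γ, a)`, the initial cluster set of `γ : (a, b) → ℂ ∪ {∞}`. -/
def initialClusterSet (a b : EReal) (γ : ℝ → RSphere) : Set RSphere :=
  curveClusterSet a b γ a

/-- `C(γ, b)`, the terminal cluster set of `γ : (a, b) → ℂ ∪ {∞}`. -/
def terminalClusterSet (a b : EReal) (γ : ℝ → RSphere) : Set RSphere :=
  curveClusterSet a b γ b

/-- `τ : (c, d) → (a, b)` is an analytic change of parameter: an increasing real-analytic bijection
with nonvanishing derivative (so its inverse is real-analytic too). -/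
structure IsAnalyticParamChange (c d a b : EReal) (τ : ℝ → ℝ) : Prop where
  analytic : ∀ s ∈ realIoo c d, AnalyticAt ℝ τ s
  deriv_pos : ∀ s ∈ realIoo c d, 0 < deriv τ s
  bijOn : Set.BijOn τ (realIoo c d) (realIoo a b)

/-- `γ : (a, b) → ℂ ∪ {∞}` has an initial analytic extension: there are an analytic curve `σ` on
some `(L, R)`, a number `A ∈ (L, R)` and an analytic change of parameter `τ : (A, R) → (a, b)` such
that `σ = γ ∘ τ` on `(A, R)`. -/
def HasInitialExtension (a b : EReal) (γ : ℝ → RSphere) : Prop :=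
  ∃ (L R : EReal) (σ : ℝ → RSphere) (A : ℝ) (τ : ℝ → ℝ),
    IsAnalyticCurve L R σ ∧ A ∈ realIoo L R ∧ IsAnalyticParamChange A R a b τ ∧
      ∀ s ∈ realIoo A R, σ s = γ (τ s)

/-- `γ : (a, b) → ℂ ∪ {∞}` has a terminal analytic extension: there are an analytic curve `σ` on
some `(L, R)`, a number `B ∈ (L, R)` and an analytic change of parameter `τ : (L, B) → (a, b)` such
that `σ = γ ∘ τ` on `(L, B)`. -/
def HasTerminalExtension (a b : EReal) (γ : ℝ → RSphere) : Prop :=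
  ∃ (L R : EReal) (σ : ℝ → RSphere) (B : ℝ) (τ : ℝ → ℝ),
    IsAnalyticCurve L R σ ∧ B ∈ realIoo L R ∧ IsAnalyticParamChange L B a b τ ∧
      ∀ s ∈ realIoo L B, σ s = γ (τ s)

/-- `γ : (a, b) → ℂ ∪ {∞}` is maximal as an analytic curve. -/
def IsAnalyticallyMaximal (a b : EReal) (γ : ℝ → RSphere) : Prop :=
  ¬ HasInitialExtension a b γ ∧ ¬ HasTerminalExtension a b γ

/-! Each end is built separately. A continuum `K` can be visited by a sequence of complex numbers
whose steps tend to zero and whose cluster points are exactly `K` (`IsContinuum.exists_seq`):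
connectedness supplies chains with ever smaller steps in ever thinner neighbourhoods of `K`. A
lacunary entire series follows such a sequence along the positive axis with error tending to zero
(`exists_entire_tracing`).

An extension across an end forces the curve to have both a limit in the sphere and a limiting
direction there (`HasTerminalExtension.exists_direction`). If `K` has more than one point, there is
no limit. If `K` is a point, a spiral replaces the tracing function, and its direction keeps
rotating.

Both arguments survive errors `o(exp (-t / 2))`; this is what `IsEndFunction` records. So two end
functions can be glued by entire factors that are exponentially close to a step on the real line
(`tendsto_blend`). A small multiple of a Gaussian-type function, chosen by a dimension argument,
makes the derivative zero-free on the real line (`exists_const_deriv_ne_zero`). Time reversal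
reduces statements about `-∞` to `+∞`. -/

/-- Transported from the unit sphere of three-space; it gives dense sequences in `K` and
subsequences converging to cluster points. -/
instance secondCountableTopology_rsphere : SecondCountableTopology RSphere := by
  have e := onePointEquivSphereOfFinrankEq (ι := Fin 3) (V := ℂ) (by simp)
  exact e.secondCountableTopology

/-! ### Planar traces of neighbourhoods in the sphere -/

theorem isPreconnected_setOf_lt_norm (r : ℝ) (hr : 0 < r) :
    IsPreconnected {z : ℂ | r < ‖z‖} := by
  have h : {z : ℂ | r < ‖z‖} = Complex.exp '' {z : ℂ | Real.log r < z.re} := by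
    ext z
    simp only [Set.mem_ofPred_eq, Set.mem_image]
    constructor
    · intro hz
      have hz0 : z ≠ 0 := by
        rintro rfl
        simp at hz
        linarith
      exact ⟨Complex.log z, by rw [Complex.log_re]; exact Real.log_lt_log hr hz,
        Complex.exp_log hz0⟩
    · rintro ⟨w, hw, rfl⟩
      rw [Complex.norm_exp]
      exact (Real.log_lt_iff_lt_exp hr).1 hw
  rw [h]
  exact (convex_halfSpace_re_gt _).isPreconnected.image _ Complex.continuous_exp.continuousOn

/-- A basis of connected neighbourhoods of a point of the sphere, intersected with the plane. -/
def planeNbhd (n : ℕ) : RSphere → Set ℂ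
  | none => {z | (n : ℝ) + 1 < ‖z‖}
  | some w => Metric.ball w (1 / ((n : ℝ) + 1))

@[simp] theorem planeNbhd_infty (n : ℕ) :
    planeNbhd n OnePoint.infty = {z | (n : ℝ) + 1 < ‖z‖} := rfl

@[simp] theorem planeNbhd_coe (n : ℕ) (w : ℂ) :
    planeNbhd n (w : RSphere) = Metric.ball w (1 / ((n : ℝ) + 1)) := rfl

theorem isPreconnected_planeNbhd (n : ℕ) (p : RSphere) : IsPreconnected (planeNbhd n p) := by
  induction p using OnePoint.rec with
  | infty => exact isPreconnected_setOf_lt_norm _ (by positivity)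
  | coe w => exact Metric.isPreconnected_ball

theorem planeNbhd_nonempty (n : ℕ) (p : RSphere) : (planeNbhd n p).Nonempty := by
  induction p using OnePoint.rec with
  | infty =>
    refine ⟨((n + 2 : ℝ) : ℂ), ?_⟩
    simp only [planeNbhd_infty, Set.mem_ofPred_eq, Complex.norm_real, Real.norm_eq_abs]
    rw [abs_of_pos (by positivity)]
    linarith
  | coe w => exact ⟨w, by simp; positivity⟩

theorem planeNbhd_anti {m n : ℕ} (h : m ≤ n) (p : RSphere) : planeNbhd n p ⊆ planeNbhd m p := by
  have h' : (m : ℝ) ≤ n := by exact_mod_cast h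
  induction p using OnePoint.rec with
  | infty =>
    intro z hz
    simp only [planeNbhd_infty, Set.mem_ofPred_eq] at hz ⊢
    linarith
  | coe w =>
    refine Metric.ball_subset_ball ?_
    gcongr

theorem tendsto_coe_infty_iff {α : Type*} {l : Filter α} {u : α → ℂ} :
    Tendsto (fun a => (u a : RSphere)) l (𝓝 OnePoint.infty) ↔
      Tendsto (fun a => ‖u a‖) l atTop := by
  rw [tendsto_norm_atTop_iff_cobounded, Metric.cobounded_eq_cocompact,
    ← coclosedCompact_eq_cocompact, ← OnePoint.comap_coe_nhds_infty, tendsto_comap_iff]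
  rfl

theorem tendsto_coe_coe_iff {α : Type*} {l : Filter α} {u : α → ℂ} {w : ℂ} :
    Tendsto (fun a => (u a : RSphere)) l (𝓝 (w : RSphere)) ↔ Tendsto u l (𝓝 w) :=
  (OnePoint.isOpenEmbedding_coe.tendsto_nhds_iff).symm

theorem tendsto_coe_of_tendsto_sub {α : Type*} {l : Filter α} {u v : α → ℂ} {w : RSphere}
    (hu : Tendsto (fun a => (u a : RSphere)) l (𝓝 w))
    (huv : Tendsto (fun a => v a - u a) l (𝓝 0)) :
    Tendsto (fun a => (v a : RSphere)) l (𝓝 w) := by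
  induction w using OnePoint.rec with
  | infty =>
    rw [tendsto_coe_infty_iff] at hu ⊢
    have h1 := huv.norm
    refine tendsto_atTop_mono' l ?_ (tendsto_atTop_add_const_right l (-1) hu)
    filter_upwards [h1.eventually (gt_mem_nhds (show ‖(0 : ℂ)‖ < 1 by simp))] with a ha
    have := norm_sub_norm_le (u a) (v a)
    rw [norm_sub_rev] at this
    linarith
  | coe w =>
    rw [tendsto_coe_coe_iff] at hu ⊢
    simpa using huv.add hu

theorem eventually_planeNbhd_subset {p : RSphere} {V : Set RSphere} (hV : V ∈ 𝓝 p) :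
    ∀ᶠ n in atTop, ∀ z ∈ planeNbhd n p, (z : RSphere) ∈ V := by
  by_contra h
  simp only [not_eventually, not_forall] at h
  obtain ⟨φ, hφ, hh⟩ := extraction_of_frequently_atTop h
  choose z hz hzV using hh
  have : Tendsto (fun n => (z n : RSphere)) atTop (𝓝 p) := by
    have hφ' : Tendsto (fun n => (φ n : ℝ) + 1) atTop atTop :=
      tendsto_atTop_add_const_right _ _ (tendsto_natCast_atTop_atTop.comp hφ.tendsto_atTop)
    induction p using OnePoint.rec with
    | infty =>
      rw [tendsto_coe_infty_iff]
      exact tendsto_atTop_mono (fun n => (hz n).le) hφ'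
    | coe w =>
      rw [tendsto_coe_coe_iff, tendsto_iff_dist_tendsto_zero]
      refine squeeze_zero (fun _ => dist_nonneg) (fun n => (hz n).le) ?_
      simpa [Function.comp_def] using tendsto_inv_atTop_zero.comp hφ'
  obtain ⟨n, hn⟩ := (this.eventually hV).exists
  exact hzV n hn

/-- Local overlap lets chains in the plane pass between the neighbourhoods of nearby points of `K`,
even when one of them is `∞`. A finite `p'` close to `p` is itself a common point. -/
theorem eventually_planeNbhd_inter_nonempty (n : ℕ) (p : RSphere) :
    ∀ᶠ p' in 𝓝 p, (planeNbhd n p ∩ planeNbhd n p').Nonempty := by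
  have key : ∀ w : ℂ, w ∈ planeNbhd n p → (planeNbhd n p ∩ planeNbhd n (w : RSphere)).Nonempty :=
    fun w hw => ⟨w, hw, by simp; positivity⟩
  have hself : (planeNbhd n p ∩ planeNbhd n p).Nonempty := by
    simpa using planeNbhd_nonempty n p
  induction p using OnePoint.rec with
  | infty =>
    rw [OnePoint.nhds_infty_eq, eventually_sup]
    refine ⟨?_, by simpa using planeNbhd_nonempty n OnePoint.infty⟩
    rw [eventually_map, coclosedCompact_eq_cocompact, ← Metric.cobounded_eq_cocompact]
    filter_upwards [tendsto_norm_cobounded_atTop.eventually_gt_atTop ((n : ℝ) + 1)] with z hz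
    exact key z hz
  | coe w =>
    rw [OnePoint.nhds_coe_eq, eventually_map]
    filter_upwards [Metric.ball_mem_nhds w (show 0 < 1 / ((n : ℝ) + 1) by positivity)] with z hz
    exact key z hz

/-! ### Slow sequences clustering exactly on a continuum -/

theorem isPreconnected_reflTransGen {X : Type*} [TopologicalSpace X] {s : Set X}
    (hs : IsPreconnected s) (r : X → X → Prop) (hsymm : ∀ x y, r x y → r y x)
    (hloc : ∀ x ∈ s, ∀ᶠ y in 𝓝[s] x, r x y) {x y : X} (hx : x ∈ s) (hy : y ∈ s) :
    Relation.ReflTransGen r x y := by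
  refine hs.induction₂' (fun a b => Relation.ReflTransGen r a b) (fun a ha => ?_)
    (fun _ _ _ _ _ _ hab hbc => hab.trans hbc) hx hy
  filter_upwards [hloc a ha] with b hb
  exact ⟨.single hb, .single (hsymm _ _ hb)⟩

/-- The points of the plane which lie in the `n`-th neighbourhood of some point of `K`. -/
def planeThickening (n : ℕ) (K : Set RSphere) : Set ℂ := ⋃ p ∈ K, planeNbhd n p

theorem planeThickening_anti {m n : ℕ} (h : m ≤ n) (K : Set RSphere) :
    planeThickening n K ⊆ planeThickening m K :=
  Set.iUnion₂_mono fun p _ => planeNbhd_anti h p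

/-- Connectedness is used twice: each `planeNbhd` is connected, so it has `ε`-chains; and `K` is
connected, so overlapping neighbourhoods link any two of its points. -/
theorem planeThickening_chain {K : Set RSphere} (hK : IsPreconnected K) (n : ℕ) {ε : ℝ}
    (hε : 0 < ε) {a b : ℂ} (ha : a ∈ planeThickening n K) (hb : b ∈ planeThickening n K) :
    Relation.ReflTransGen
      (fun x y => (x ∈ planeThickening n K ∧ y ∈ planeThickening n K) ∧ dist x y < ε) a b := by
  set r : ℂ → ℂ → Prop :=
    fun x y => (x ∈ planeThickening n K ∧ y ∈ planeThickening n K) ∧ dist x y < ε with hr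
  have hrs : ∀ x y, r x y → r y x := fun x y h => ⟨h.1.symm, by rw [dist_comm]; exact h.2⟩
  have hsub : ∀ p ∈ K, planeNbhd n p ⊆ planeThickening n K := fun p hp =>
    Set.subset_biUnion_of_mem (u := fun p => planeNbhd n p) hp
  have h1 : ∀ p ∈ K, ∀ x ∈ planeNbhd n p, ∀ y ∈ planeNbhd n p, Relation.ReflTransGen r x y := by
    intro p hp x hx y hy
    refine isPreconnected_reflTransGen (isPreconnected_planeNbhd n p) r hrs ?_ hx hy
    intro x hx
    filter_upwards [self_mem_nhdsWithin,
      mem_nhdsWithin_of_mem_nhds (Metric.ball_mem_nhds x hε)] with y hy hxy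
    exact ⟨⟨hsub p hp hx, hsub p hp hy⟩, Metric.mem_ball'.1 hxy⟩
  simp only [planeThickening, Set.mem_iUnion, exists_prop] at ha hb
  obtain ⟨p, hp, hap⟩ := ha
  obtain ⟨p', hp', hbp⟩ := hb
  refine hK.induction₂' (fun p p' => ∀ x ∈ planeNbhd n p, ∀ y ∈ planeNbhd n p',
    Relation.ReflTransGen r x y) (fun p hp => ?_) ?_ hp hp' a hap b hbp
  · filter_upwards [self_mem_nhdsWithin,
      mem_nhdsWithin_of_mem_nhds (eventually_planeNbhd_inter_nonempty n p)] with p' hp' hpp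
    obtain ⟨z, hz, hz'⟩ := hpp
    exact ⟨fun x hx y hy => (h1 p hp x hx z hz).trans (h1 p' hp' z hz' y hy),
      fun x hx y hy => (h1 p' hp' x hx z hz').trans (h1 p hp z hz y hy)⟩
  · intro p q s _ _ _ h h' x hx y hy
    obtain ⟨z, hz⟩ := planeNbhd_nonempty n q
    exact (h x hx z hz).trans (h' z hz y hy)

theorem exists_chain_of_reflTransGen {α : Type*} {r : α → α → Prop} {a b : α}
    (h : Relation.ReflTransGen r a b) (hb : r b b) :
    ∃ (N : ℕ) (c : ℕ → α), c 0 = a ∧ c (N + 1) = b ∧ ∀ i ≤ N, r (c i) (c (i + 1)) := by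
  induction h using Relation.ReflTransGen.head_induction_on with
  -- `r b b` provides one idle step, so that every chain has positive length and concatenation
  -- always advances.
  | refl => exact ⟨0, fun _ => b, rfl, rfl, fun _ _ => hb⟩
  | @head x y hxy _ ih =>
    obtain ⟨N, c, h0, hN, hc⟩ := ih
    refine ⟨N + 1, fun i => Nat.casesOn i x c, rfl, hN, fun i hi => ?_⟩
    cases i with
    | zero => simpa [h0] using hxy
    | succ i => exact hc i (by omega)

/-- Concatenation of infinitely many finite chains. -/
theorem exists_seq_of_chains {α : Type*} (r : ℕ → α → α → Prop) (x : ℕ → α)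
    (h : ∀ m, ∃ (N : ℕ) (c : ℕ → α), c 0 = x m ∧ c (N + 1) = x (m + 1) ∧
      ∀ i ≤ N, r m (c i) (c (i + 1))) :
    ∃ (q : ℕ → α) (m : ℕ → ℕ), Tendsto m atTop atTop ∧ (∀ k, r (m k) (q k) (q (k + 1))) ∧
      ∀ j, ∃ k, m k = j ∧ q k = x j := by
  choose N c hc0 hcN hc using h
  -- A state is (chain, position). The last point of a chain is not a state of its own: it is
  -- position `0` of the next chain.
  let step : ℕ × ℕ → ℕ × ℕ := fun s => if s.2 < N s.1 then (s.1, s.2 + 1) else (s.1 + 1, 0)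
  let s : ℕ → ℕ × ℕ := fun k => step^[k] (0, 0)
  have hs : ∀ k, s (k + 1) = step (s k) := fun k => Function.iterate_succ_apply' step k _
  have hle : ∀ k, (s k).2 ≤ N (s k).1 := by
    intro k
    induction k with
    | zero => exact Nat.zero_le _
    | succ k ih =>
      rw [hs]
      by_cases hk : (s k).2 < N (s k).1
      · simp only [step, if_pos hk]; exact hk
      · simp only [step, if_neg hk]; exact Nat.zero_le _
  have hmono : Monotone fun k => (s k).1 := by
    refine monotone_nat_of_le_succ fun k => ?_
    simp only [hs, step]
    split_ifs <;> simp
  have hrun : ∀ k, (s k).2 = 0 → ∀ i ≤ N (s k).1, s (k + i) = ((s k).1, i) := by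
    intro k hk i
    induction i with
    | zero => intro _; exact Prod.ext rfl hk
    | succ i ih =>
      intro hi
      have := ih (by omega)
      rw [← add_assoc, hs, this]
      simp only [step]
      rw [if_pos (by omega)]
  have hvisit : ∀ j, ∃ k, s k = (j, 0) := by
    intro j
    induction j with
    | zero => exact ⟨0, rfl⟩
    | succ j ih =>
      obtain ⟨k, hk⟩ := ih
      have := hrun k (by rw [hk]) (N j) (by rw [hk])
      refine ⟨k + N j + 1, ?_⟩
      rw [hs, this, hk]
      simp [step]
  refine ⟨fun k => c (s k).1 (s k).2, fun k => (s k).1, ?_, fun k => ?_, fun j => ?_⟩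
  · refine tendsto_atTop_atTop_of_monotone hmono fun j => ?_
    obtain ⟨k, hk⟩ := hvisit j
    exact ⟨k, by rw [hk]⟩
  · have := hc (s k).1 (s k).2 (hle k)
    have h2 : c (s (k + 1)).1 (s (k + 1)).2 = c (s k).1 ((s k).2 + 1) := by
      rw [hs]
      by_cases hk : (s k).2 < N (s k).1
      · simp only [step, if_pos hk]
      · simp only [step, if_neg hk]
        rw [hc0, ← hcN, le_antisymm (hle k) (not_lt.1 hk)]
    simp only [h2]
    exact this
  · obtain ⟨k, hk⟩ := hvisit j
    exact ⟨k, by simp only [hk], by simp only [hk]; exact hc0 j⟩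

/-- Along a subsequence tending to `w`, look at the centres in `K`. If infinitely many are `∞`, then
`w = ∞`; otherwise the centres are eventually finite, within `1 / (m + 1)` of the sequence, and tend
to `w` as well. -/
theorem mem_of_frequently_mem_planeThickening {K : Set RSphere} (hK : IsClosed K) {w : RSphere}
    {q : ℕ → ℂ} {m : ℕ → ℕ} (hm : Tendsto m atTop atTop)
    (hq : ∀ k, q k ∈ planeThickening (m k) K)
    (hw : MapClusterPt w atTop (fun k => (q k : RSphere))) : w ∈ K := by
  obtain ⟨φ, hφ, hlim⟩ := hw.tendsto_subseq
  have hmφ : Tendsto (fun k => (m (φ k) : ℝ) + 1) atTop atTop :=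
    tendsto_atTop_add_const_right _ _
      (tendsto_natCast_atTop_atTop.comp (hm.comp hφ.tendsto_atTop))
  have hq' : ∀ k, ∃ p ∈ K, q (φ k) ∈ planeNbhd (m (φ k)) p := fun k => by
    simpa [planeThickening] using hq (φ k)
  choose p hpK hp using hq'
  by_cases hinf : ∃ᶠ k in atTop, p k = OnePoint.infty
  · obtain ⟨ψ, hψ, hpψ⟩ := extraction_of_frequently_atTop hinf
    have h1 : Tendsto (fun k => (q (φ (ψ k)) : RSphere)) atTop (𝓝 OnePoint.infty) := by
      rw [tendsto_coe_infty_iff]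
      refine tendsto_atTop_mono (fun k => ?_) (hmφ.comp hψ.tendsto_atTop)
      have := hp (ψ k)
      rw [hpψ k] at this
      exact le_of_lt this
    rw [tendsto_nhds_unique (hlim.comp hψ.tendsto_atTop) h1, ← hpψ 0]
    exact hpK _
  · rw [not_frequently] at hinf
    have hfin : ∀ k, ∃ z : ℂ, p k ≠ OnePoint.infty → p k = z := fun k => by
      by_cases h : p k = OnePoint.infty
      · exact ⟨0, fun h' => absurd h h'⟩
      · obtain ⟨z, hz⟩ := OnePoint.ne_infty_iff_exists.1 h
        exact ⟨z, fun _ => hz.symm⟩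
    choose z hz using hfin
    have hsub : Tendsto (fun k => z k - q (φ k)) atTop (𝓝 0) := by
      rw [tendsto_zero_iff_norm_tendsto_zero]
      refine squeeze_zero' (Eventually.of_forall fun _ => norm_nonneg _) ?_
        (tendsto_inv_atTop_zero.comp hmφ)
      filter_upwards [hinf] with k hk
      have := hp k
      rw [hz k hk, planeNbhd_coe, Metric.mem_ball', dist_eq_norm] at this
      simpa using this.le
    have h2 := tendsto_coe_of_tendsto_sub hlim hsub
    refine hK.mem_of_tendsto h2 ?_
    filter_upwards [hinf] with k hk
    rw [← hz k hk]
    exact hpK k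

/-- Every continuum of the sphere is the set of cluster points of a sequence of complex numbers
whose successive differences tend to zero. -/
theorem IsContinuum.exists_seq {K : Set RSphere} (hK : IsContinuum K) :
    ∃ q : ℕ → ℂ, Tendsto (fun k => q (k + 1) - q k) atTop (𝓝 0) ∧
      ∀ w, MapClusterPt w atTop (fun k => (q k : RSphere)) ↔ w ∈ K := by
  have : Nonempty K := hK.2.nonempty.to_subtype
  let p : ℕ → K := TopologicalSpace.denseSeq K
  -- Unpairing makes every dense point a target at infinitely many levels `m`.
  have hx : ∀ m, ∃ x : ℂ, x ∈ planeNbhd m (p (Nat.unpair m).1 : RSphere) := fun m =>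
    planeNbhd_nonempty m _
  choose x hx using hx
  have hxW : ∀ m, x m ∈ planeThickening m K := fun m =>
    Set.mem_biUnion (p (Nat.unpair m).1).2 (hx m)
  let r : ℕ → ℂ → ℂ → Prop := fun m a b =>
    (a ∈ planeThickening m K ∧ b ∈ planeThickening m K) ∧ dist a b < 1 / ((m : ℝ) + 1)
  have hpos : ∀ m : ℕ, 0 < 1 / ((m : ℝ) + 1) := fun m => by positivity
  have hxW' : ∀ m, x (m + 1) ∈ planeThickening m K := fun m =>
    planeThickening_anti m.le_succ K (hxW (m + 1))
  obtain ⟨q, m, hm, hr, hvis⟩ := exists_seq_of_chains r x fun m =>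
    exists_chain_of_reflTransGen
      (planeThickening_chain hK.2.isPreconnected m (hpos m) (hxW m) (hxW' m))
      ⟨⟨hxW' m, hxW' m⟩, by rw [dist_self]; exact hpos m⟩
  refine ⟨q, ?_, fun w => ⟨fun hw => ?_, fun hw => ?_⟩⟩
  · rw [tendsto_zero_iff_norm_tendsto_zero]
    have hm' : Tendsto (fun k => (m k : ℝ) + 1) atTop atTop :=
      tendsto_atTop_add_const_right _ _ (tendsto_natCast_atTop_atTop.comp hm)
    refine squeeze_zero (fun _ => norm_nonneg _) (fun k => ?_) (tendsto_inv_atTop_zero.comp hm')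
    have := (hr k).2.le
    rw [dist_comm, dist_eq_norm] at this
    simpa using this
  · exact mem_of_frequently_mem_planeThickening hK.1.isClosed hm (fun k => (hr k).1.1) hw
  · have hcl : IsClosed {w : RSphere | MapClusterPt w atTop (fun k => (q k : RSphere))} :=
      isClosed_setOfPred_clusterPt
    have hdense : w ∈ closure (Set.range fun i => (p i : RSphere)) := by
      have h1 : (⟨w, hw⟩ : K) ∈ closure (Set.range p) :=
        TopologicalSpace.denseRange_denseSeq K _
      have h2 := image_closure_subset_closure_image continuous_subtype_val
        (Set.mem_image_of_mem Subtype.val h1)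
      rwa [← Set.range_comp] at h2
    refine hcl.closure_subset_iff.2 ?_ hdense
    rintro _ ⟨i, rfl⟩
    refine mapClusterPt_iff_frequently.2 fun V hV => frequently_atTop.2 fun N => ?_
    obtain ⟨M, hM⟩ := eventually_atTop.1 (eventually_planeNbhd_subset hV)
    obtain ⟨M', hM'⟩ : ∃ M', ∀ k < N, m k < M' := by
      refine ⟨(Finset.range N).sup m + 1, fun k hk => ?_⟩
      exact Nat.lt_succ_of_le (Finset.le_sup (f := m) (Finset.mem_range.2 hk))
    -- A large second component makes the level at least `M` (neighbourhood inside `V`) and at least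
    -- `M'` (time not before `N`).
    obtain ⟨k, hk, hqk⟩ := hvis (Nat.pair i (max M M'))
    have hge : max M M' ≤ Nat.pair i (max M M') := Nat.right_le_pair _ _
    refine ⟨k, ?_, ?_⟩
    · by_contra hlt
      have := hM' k (not_le.1 hlt)
      have := le_max_right M M'
      omega
    · rw [hqk]
      refine hM _ ((le_max_left _ _).trans hge) _ ?_
      simpa using hx (Nat.pair i (max M M'))

/-! ### Tracing a slow sequence by a lacunary entire series -/

/-- An entire function interpolating slowly between the successive values of a sequence with
differences `d`, the transition number `j` taking place at distance about `2 ^ j` from the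
origin. -/
noncomputable def lacunarySum (d : ℕ → ℂ) (z : ℂ) : ℂ :=
  ∑' j, d j * (1 - Complex.exp (-(z ^ 2 / 4 ^ j)))

theorem norm_one_sub_exp_neg_le (w : ℂ) : ‖1 - Complex.exp (-w)‖ ≤ ‖w‖ * Real.exp ‖w‖ := by
  have := Complex.norm_exp_sub_sum_le_norm_mul_exp (-w) 1
  simpa [norm_sub_rev] using this

theorem summable_inv_four_pow : Summable fun j : ℕ => ((4 : ℝ) ^ j)⁻¹ := by
  simpa using summable_geometric_of_lt_one (r := (4 : ℝ)⁻¹) (by norm_num) (by norm_num)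

theorem lacunarySum_term_norm_le {d : ℕ → ℂ} {D : ℝ} (hd : ∀ j, ‖d j‖ ≤ D) {R : ℝ} {z : ℂ}
    (hz : ‖z‖ ≤ R) (j : ℕ) :
    ‖d j * (1 - Complex.exp (-(z ^ 2 / 4 ^ j)))‖ ≤
      D * (R ^ 2 * Real.exp (R ^ 2)) * ((4 : ℝ) ^ j)⁻¹ := by
  have hD : 0 ≤ D := (norm_nonneg _).trans (hd 0)
  have h4 : (1 : ℝ) ≤ 4 ^ j := one_le_pow₀ (by norm_num)
  have hw : ‖z ^ 2 / 4 ^ j‖ = ‖z‖ ^ 2 * ((4 : ℝ) ^ j)⁻¹ := by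
    simp [div_eq_mul_inv]
  have h2 : ‖z‖ ^ 2 ≤ R ^ 2 := by gcongr
  rw [norm_mul, mul_assoc]
  refine mul_le_mul (hd j) ?_ (norm_nonneg _) hD
  refine (norm_one_sub_exp_neg_le _).trans ?_
  have h3 : ‖z ^ 2 / 4 ^ j‖ ≤ R ^ 2 := by
    rw [hw]
    exact (mul_le_of_le_one_right (by positivity) (inv_le_one_of_one_le₀ h4)).trans h2
  calc ‖z ^ 2 / 4 ^ j‖ * Real.exp ‖z ^ 2 / 4 ^ j‖
      ≤ (R ^ 2 * ((4 : ℝ) ^ j)⁻¹) * Real.exp (R ^ 2) := by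
        gcongr
        rw [hw]
        gcongr
    _ = _ := by ring

theorem differentiable_lacunarySum {d : ℕ → ℂ} {D : ℝ} (hd : ∀ j, ‖d j‖ ≤ D) :
    Differentiable ℂ (lacunarySum d) := by
  intro z
  have h := Complex.differentiableOn_tsum_of_summable_norm
    (U := Metric.ball (0 : ℂ) (‖z‖ + 1))
    (F := fun j z => d j * (1 - Complex.exp (-(z ^ 2 / 4 ^ j))))
    (summable_inv_four_pow.mul_left (D * ((‖z‖ + 1) ^ 2 * Real.exp ((‖z‖ + 1) ^ 2))))
    (fun j => by fun_prop) Metric.isOpen_ball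
    (fun j w hw => lacunarySum_term_norm_le hd (by simpa using (Metric.mem_ball.1 hw).le) j)
  exact (h z (by simp)).differentiableAt (Metric.isOpen_ball.mem_nhds (by simp))

theorem summable_lacunarySum_term {d : ℕ → ℂ} {D : ℝ} (hd : ∀ j, ‖d j‖ ≤ D) (z : ℂ) :
    Summable fun j => d j * (1 - Complex.exp (-(z ^ 2 / 4 ^ j))) :=
  .of_norm_bounded (summable_inv_four_pow.mul_left _) (lacunarySum_term_norm_le hd le_rfl)

theorem norm_exp_neg_sq_div (t : ℝ) (j : ℕ) :
    ‖Complex.exp (-((t : ℂ) ^ 2 / 4 ^ j))‖ = Real.exp (-(t ^ 2 / 4 ^ j)) := by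
  rw [show -((t : ℂ) ^ 2 / 4 ^ j) = ((-(t ^ 2 / 4 ^ j) : ℝ) : ℂ) by push_cast; ring,
    ← Complex.ofReal_exp, Complex.norm_real, Real.norm_of_nonneg (Real.exp_pos _).le]

theorem norm_one_sub_exp_neg_sq_div_le (t : ℝ) (j : ℕ) :
    ‖1 - Complex.exp (-((t : ℂ) ^ 2 / 4 ^ j))‖ ≤ t ^ 2 * ((4 : ℝ) ^ j)⁻¹ := by
  rw [show -((t : ℂ) ^ 2 / 4 ^ j) = ((-(t ^ 2 / 4 ^ j) : ℝ) : ℂ) by push_cast; ring,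
    ← Complex.ofReal_exp, ← Complex.ofReal_one, ← Complex.ofReal_sub, Complex.norm_real,
    Real.norm_of_nonneg (sub_nonneg.2 (Real.exp_le_one_iff.2 (neg_nonpos.2 (by positivity)))),
    ← div_eq_mul_inv]
  linarith [Real.add_one_le_exp (-(t ^ 2 / 4 ^ j))]

theorem norm_lacunarySum_ofReal_le {d : ℕ → ℂ} {D : ℝ} (hd : ∀ j, ‖d j‖ ≤ D) (t : ℝ) :
    ‖lacunarySum d t‖ ≤ D * t ^ 2 * ∑' j : ℕ, ((4 : ℝ) ^ j)⁻¹ := by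
  rw [← tsum_mul_left]
  refine tsum_of_norm_bounded (summable_inv_four_pow.mul_left _).hasSum fun j => ?_
  rw [norm_mul, mul_assoc]
  exact mul_le_mul (hd j) (norm_one_sub_exp_neg_sq_div_le t j) (norm_nonneg _)
    ((norm_nonneg _).trans (hd 0))

theorem exp_neg_le_inv {x : ℝ} (hx : 0 < x) : Real.exp (-x) ≤ x⁻¹ := by
  rw [Real.exp_neg]
  exact inv_anti₀ hx (by linarith [Real.add_one_le_exp x])

/-- For `t ^ 2` between `4 ^ k` and `4 ^ (k + 1)`, transitions `j ≥ k` have hardly begun (`1 - exp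
(-x) ≤ x`) and those with `j < k` are nearly complete (`exp (-x) ≤ 1 / x`). The error is thus an
average of `‖d j‖` with weights decaying geometrically away from `k`. -/
theorem norm_lacunarySum_sub_sum_le {d : ℕ → ℂ} {D : ℝ} (hd : ∀ j, ‖d j‖ ≤ D) {t : ℝ} {k : ℕ}
    (h1 : (4 : ℝ) ^ k ≤ t ^ 2) (h2 : t ^ 2 ≤ 4 * 4 ^ k) :
    ‖lacunarySum d t - ∑ j ∈ Finset.range k, d j‖ ≤
      4 * (∑' i, ‖d (k + i)‖ * ((4 : ℝ) ^ i)⁻¹) +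
        ∑' i, ‖d (k - 1 - i)‖ * ((4 : ℝ) ^ i)⁻¹ := by
  have hsum : ∀ e : ℕ → ℂ, (∀ j, ‖e j‖ ≤ D) → Summable fun i => ‖e i‖ * ((4 : ℝ) ^ i)⁻¹ :=
    fun e he => .of_nonneg_of_le (fun i => by positivity)
      (fun i => mul_le_mul_of_nonneg_right (he i) (by positivity))
      (summable_inv_four_pow.mul_left D)
  have heq : lacunarySum d t - ∑ j ∈ Finset.range k, d j =
      (∑' i, d (k + i) * (1 - Complex.exp (-((t : ℂ) ^ 2 / 4 ^ (k + i))))) -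
        ∑ j ∈ Finset.range k, d j * Complex.exp (-((t : ℂ) ^ 2 / 4 ^ j)) := by
    rw [lacunarySum, ← (summable_lacunarySum_term hd t).sum_add_tsum_nat_add k]
    simp only [mul_sub, mul_one, Finset.sum_sub_distrib, add_comm k]
    ring
  rw [heq]
  refine (norm_sub_le _ _).trans (add_le_add ?_ ?_)
  · rw [← tsum_mul_left]
    refine tsum_of_norm_bounded ((hsum (fun i => d (k + i)) fun i => hd _).mul_left 4).hasSum
      fun i => ?_
    rw [norm_mul, mul_left_comm]
    refine mul_le_mul_of_nonneg_left ((norm_one_sub_exp_neg_sq_div_le t _).trans ?_)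
      (norm_nonneg _)
    rw [pow_add, mul_inv, ← mul_assoc]
    refine mul_le_mul_of_nonneg_right ?_ (by positivity)
    rw [← div_eq_mul_inv, div_le_iff₀ (by positivity)]
    exact h2
  · rw [← Finset.sum_range_reflect]
    -- For `i ≥ k` the truncated index `k - 1 - i` is `0`; these extra nonnegative terms only
    -- enlarge the bound.
    refine (norm_sum_le _ _).trans (le_trans (Finset.sum_le_sum fun i hi => ?_)
      ((hsum (fun i => d (k - 1 - i)) fun i => hd _).sum_le_tsum (Finset.range k)
        fun i _ => by positivity))
    rw [norm_mul, norm_exp_neg_sq_div]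
    refine mul_le_mul_of_nonneg_left ?_ (norm_nonneg _)
    have hi' : k - 1 - i + (i + 1) = k := by have := Finset.mem_range.1 hi; omega
    have h3 : (4 : ℝ) ^ i ≤ t ^ 2 / 4 ^ (k - 1 - i) := by
      rw [le_div_iff₀ (by positivity), ← pow_add]
      exact (pow_le_pow_right₀ (by norm_num) (by omega)).trans h1
    exact (exp_neg_le_inv (lt_of_lt_of_le (by positivity) h3)).trans
      (inv_anti₀ (by positivity) h3)

/-- Dominated convergence; `σ` covers both the forward indices `k + i` and the backward ones `k - 1
- i`. -/
theorem tendsto_tsum_mul_inv_four_pow {d : ℕ → ℂ} {D : ℝ} (hd : ∀ j, ‖d j‖ ≤ D)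
    (hd0 : Tendsto d atTop (𝓝 0)) {σ : ℕ → ℕ → ℕ} (hσ : ∀ i, Tendsto (σ · i) atTop atTop) :
    Tendsto (fun k => ∑' i, ‖d (σ k i)‖ * ((4 : ℝ) ^ i)⁻¹) atTop (𝓝 0) := by
  have := tendsto_tsum_of_dominated_convergence (𝓕 := atTop)
    (f := fun k i => ‖d (σ k i)‖ * ((4 : ℝ) ^ i)⁻¹) (g := fun _ => 0)
    (summable_inv_four_pow.mul_left D) (fun i => by
      simpa using ((hd0.comp (hσ i)).norm).mul_const ((4 : ℝ) ^ i)⁻¹)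
    (Eventually.of_forall fun k i => by
      rw [norm_mul, norm_norm, Real.norm_of_nonneg (by positivity : (0 : ℝ) ≤ ((4 : ℝ) ^ i)⁻¹)]
      exact mul_le_mul_of_nonneg_right (hd _) (by positivity))
  simpa using this

/-- A sequence whose successive differences tend to zero is traced along the positive real axis
by an entire function. -/
theorem exists_entire_tracing {q : ℕ → ℂ} (hq : Tendsto (fun k => q (k + 1) - q k) atTop (𝓝 0)) :
    ∃ A : ℂ → ℂ, Differentiable ℂ A ∧ (∃ C, ∀ t : ℝ, ‖A t‖ ≤ C * (1 + t ^ 2)) ∧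
      ∃ k : ℝ → ℕ, Tendsto k atTop atTop ∧
        (∃ s : ℕ → ℝ, Tendsto s atTop atTop ∧ ∀ n, k (s n) = n) ∧
        Tendsto (fun t : ℝ => A t - q (k t)) atTop (𝓝 0) := by
  set d : ℕ → ℂ := fun k => q (k + 1) - q k with hdef
  obtain ⟨D, hD⟩ := hq.norm.bddAbove_range
  have hd : ∀ j, ‖d j‖ ≤ D := fun j => hD ⟨j, rfl⟩
  have hD0 : 0 ≤ D := (norm_nonneg _).trans (hd 0)
  have hT : 0 ≤ ∑' j : ℕ, ((4 : ℝ) ^ j)⁻¹ := tsum_nonneg fun j => by positivity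
  have hk : Tendsto (fun t : ℝ => Nat.log 2 ⌊t⌋₊) atTop atTop := by
    refine Tendsto.comp (g := Nat.log 2) ?_ tendsto_nat_floor_atTop
    exact tendsto_atTop_atTop_of_monotone (fun _ _ h => Nat.log_mono_right h)
      fun n => ⟨2 ^ n, (Nat.log_pow (by norm_num) n).ge⟩
  refine ⟨fun z => q 0 + lacunarySum d z, (differentiable_lacunarySum hd).const_add _,
    ⟨‖q 0‖ + D * ∑' j : ℕ, ((4 : ℝ) ^ j)⁻¹, fun t => ?_⟩, fun t => Nat.log 2 ⌊t⌋₊, hk,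
    ⟨fun n => 2 ^ n, tendsto_pow_atTop_atTop_of_one_lt (by norm_num), fun n => ?_⟩, ?_⟩
  · refine (norm_add_le _ _).trans ?_
    have h1 := norm_lacunarySum_ofReal_le hd t
    have h2 : 0 ≤ ‖q 0‖ * t ^ 2 := by positivity
    have h3 : 0 ≤ D * ∑' j : ℕ, ((4 : ℝ) ^ j)⁻¹ := by positivity
    nlinarith
  · have : ((2 : ℝ) ^ n) = ((2 ^ n : ℕ) : ℝ) := by push_cast; rfl
    simp only [this, Nat.floor_natCast]
    exact Nat.log_pow (by norm_num) n
  · have hb := ((tendsto_tsum_mul_inv_four_pow hd hq (σ := fun k i => k + i)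
      fun i => tendsto_add_atTop_nat i).const_mul 4).add
      (tendsto_tsum_mul_inv_four_pow hd hq (σ := fun k i => k - 1 - i)
        fun i => (tendsto_sub_atTop_nat i).comp (tendsto_sub_atTop_nat 1))
    rw [mul_zero, add_zero] at hb
    rw [tendsto_zero_iff_norm_tendsto_zero]
    refine squeeze_zero' (Eventually.of_forall fun _ => norm_nonneg _) ?_ (hb.comp hk)
    filter_upwards [eventually_ge_atTop (1 : ℝ)] with t ht
    have hfl : ⌊t⌋₊ ≠ 0 := (Nat.floor_pos.2 ht).ne'
    have hlo : (2 : ℝ) ^ Nat.log 2 ⌊t⌋₊ ≤ t := by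
      have := Nat.pow_log_le_self 2 hfl
      exact (by exact_mod_cast this : (2 : ℝ) ^ Nat.log 2 ⌊t⌋₊ ≤ ⌊t⌋₊).trans
        (Nat.floor_le (by linarith))
    have hhi : t ≤ 2 * 2 ^ Nat.log 2 ⌊t⌋₊ := by
      have := Nat.lt_pow_succ_log_self (b := 2) (by norm_num) ⌊t⌋₊
      have h := (Nat.floor_lt (by linarith)).1 this
      push_cast [pow_succ] at h
      linarith
    have e4 : (4 : ℝ) ^ Nat.log 2 ⌊t⌋₊ = (2 ^ Nat.log 2 ⌊t⌋₊) ^ 2 := by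
      rw [← pow_mul, mul_comm, pow_mul]; norm_num
    have := norm_lacunarySum_sub_sum_le hd (t := t) (k := Nat.log 2 ⌊t⌋₊)
      (by rw [e4]; gcongr) (by rw [e4]; nlinarith [pow_le_pow_left₀ (by linarith) hhi 2])
    -- The partial sum of differences telescopes to `q k - q 0`.
    rw [hdef, Finset.sum_range_sub, ← hdef] at this
    have e : q 0 + lacunarySum d t - q (Nat.log 2 ⌊t⌋₊) =
        lacunarySum d t - (q (Nat.log 2 ⌊t⌋₊) - q 0) := by ring
    simp only [e]
    exact this

/-! ### Terminal extensions force a limit and a direction -/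

theorem realIoo_bot_top : realIoo ⊥ ⊤ = Set.univ := by
  ext t
  simp [realIoo, EReal.bot_lt_coe, EReal.coe_lt_top]

theorem mem_terminalClusterSet_bot_top {γ : ℝ → RSphere} {w : RSphere} :
    w ∈ terminalClusterSet ⊥ ⊤ γ ↔
      ∃ t : ℕ → ℝ, Tendsto t atTop atTop ∧ Tendsto (fun n => γ (t n)) atTop (𝓝 w) := by
  simp [terminalClusterSet, curveClusterSet, realIoo_bot_top, EReal.tendsto_coe_nhds_top_iff]

theorem terminalClusterSet_eq_singleton {γ : ℝ → RSphere} {w : RSphere}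
    (h : Tendsto γ atTop (𝓝 w)) : terminalClusterSet ⊥ ⊤ γ = {w} := by
  ext w'
  rw [mem_terminalClusterSet_bot_top, Set.mem_singleton_iff]
  constructor
  · rintro ⟨t, ht, hw⟩
    exact tendsto_nhds_unique hw (h.comp ht)
  · rintro rfl
    exact ⟨fun n => n, tendsto_natCast_atTop_atTop, h.comp tendsto_natCast_atTop_atTop⟩

theorem IsAnalyticParamChange.strictMonoOn {c d a b : EReal} {τ : ℝ → ℝ}
    (h : IsAnalyticParamChange c d a b τ) : StrictMonoOn τ (realIoo c d) := by
  have hconv : Convex ℝ (realIoo c d) := by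
    refine Set.OrdConnected.convex ⟨fun x hx y hy z hz => ⟨?_, ?_⟩⟩
    · exact hx.1.trans_le (EReal.coe_le_coe_iff.2 hz.1)
    · exact (EReal.coe_le_coe_iff.2 hz.2).trans_lt hy.2
  exact strictMonoOn_of_deriv_pos hconv
    (fun s hs => (h.analytic s hs).continuousAt.continuousWithinAt)
    fun s hs => h.deriv_pos s (interior_subset hs)

theorem realIoo_coe_right_mem_nhdsLT {L : EReal} {B : ℝ} (hL : L < B) :
    realIoo L B ∈ 𝓝[<] B := by
  obtain ⟨l, hl, hlB⟩ := EReal.lt_iff_exists_real_btwn.1 hL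
  filter_upwards [Ioo_mem_nhdsLT (EReal.coe_lt_coe_iff.1 hlB)] with s hs
  exact ⟨hl.trans (EReal.coe_lt_coe_iff.2 hs.1), EReal.coe_lt_coe_iff.2 hs.2⟩

/-- An increasing bijection onto the line carries left neighbourhoods of `B` to neighbourhoods of
`+∞`, so limits of `G ∘ τ` at `B` become limits of `G` at `+∞`. -/
theorem IsAnalyticParamChange.atTop_le_map {L : EReal} {B : ℝ} (hL : L < B) {τ : ℝ → ℝ}
    (h : IsAnalyticParamChange L B ⊥ ⊤ τ) : atTop ≤ map τ (𝓝[<] B) := by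
  intro V hV
  rw [mem_map] at hV
  obtain ⟨l, hl, hlV⟩ := (mem_nhdsLT_iff_exists_Ioo_subset (a := B)).1
    (inter_mem hV (realIoo_coe_right_mem_nhdsLT hL))
  obtain ⟨l', hl', hl'B⟩ := exists_between (Set.mem_Iio.1 hl)
  filter_upwards [eventually_gt_atTop (τ l')] with t ht
  obtain ⟨s, hs, rfl⟩ := h.bijOn.surjOn (by rw [realIoo_bot_top]; trivial : t ∈ realIoo ⊥ ⊤)
  have hls : l' < s := (h.strictMonoOn.lt_iff_lt (hlV ⟨hl', hl'B⟩).2 hs).1 ht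
  exact (hlV ⟨hl'.trans hls, EReal.coe_lt_coe_iff.1 hs.2⟩).1

/-- Normalise the difference quotient; the minus sign comes from `s - B < 0`. -/
theorem HasDerivAt.tendsto_direction_left {g : ℝ → ℂ} {c : ℂ} {B : ℝ} (h : HasDerivAt g c B)
    (hc : c ≠ 0) :
    Tendsto (fun s => (g s - g B) / (‖g s - g B‖ : ℂ)) (𝓝[<] B) (𝓝 (-(c / (‖c‖ : ℂ)))) := by
  have h1 : Tendsto (slope g B) (𝓝[<] B) (𝓝 c) :=
    (hasDerivAt_iff_tendsto_slope.1 h).mono_left (nhdsWithin_mono _ fun s hs => ne_of_lt hs)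
  have h2 : Tendsto (fun s => -(slope g B s / (‖slope g B s‖ : ℂ))) (𝓝[<] B)
      (𝓝 (-(c / (‖c‖ : ℂ)))) :=
    (h1.div ((Complex.continuous_ofReal.tendsto _).comp h1.norm)
      (by simpa using hc)).neg
  refine h2.congr' ?_
  filter_upwards [self_mem_nhdsWithin] with s hs
  have hs' : s - B < 0 := sub_neg.2 hs
  have hne : ((s - B : ℝ) : ℂ) ≠ 0 := by exact_mod_cast hs'.ne
  have e : g s - g B = ((s - B : ℝ) : ℂ) * slope g B s := by
    rw [slope_def_module, Complex.real_smul, Complex.ofReal_inv, mul_inv_cancel_left₀ hne]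
  rw [e, norm_mul, Complex.norm_real, Real.norm_of_nonpos hs'.le]
  push_cast
  push_cast at hne
  rw [neg_mul, div_neg, mul_div_mul_left _ _ hne]

theorem sphereInv_coe_eq_coe {z y : ℂ} (h : sphereInv (z : RSphere) = (y : RSphere)) :
    z ≠ 0 ∧ z⁻¹ = y := by
  change (if z = 0 then OnePoint.infty else ((z⁻¹ : ℂ) : RSphere)) = (y : RSphere) at h
  split_ifs at h with hz
  · exact absurd h (OnePoint.infty_ne_coe _)
  · exact ⟨hz, OnePoint.coe_injective h⟩

/-- A curve in the plane with a terminal extension has a limit in the sphere and a limiting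
direction at this limit. -/
theorem HasTerminalExtension.exists_direction {γ : ℝ → ℂ}
    (h : HasTerminalExtension ⊥ ⊤ fun t => (γ t : RSphere)) :
    ∃ e : ℂ, e ≠ 0 ∧
      ((∃ w : ℂ, Tendsto γ atTop (𝓝 w) ∧
          Tendsto (fun t => (γ t - w) / (‖γ t - w‖ : ℂ)) atTop (𝓝 e)) ∨
        (Tendsto (fun t => ‖γ t‖) atTop atTop ∧
          Tendsto (fun t => γ t / (‖γ t‖ : ℂ)) atTop (𝓝 e))) := by
  obtain ⟨L, R, σ, B, τ, hσ, hB, hτ, hστ⟩ := h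
  have hle := hτ.atTop_le_map hB.1
  have hev := realIoo_coe_right_mem_nhdsLT hB.1
  have htr : ∀ {X : Type} {G : ℝ → X} {l : Filter X},
      Tendsto (fun s => G (τ s)) (𝓝[<] B) l → Tendsto G atTop l := fun hG =>
    (tendsto_map'_iff.2 hG).mono_left hle
  by_cases hinf : σ B = OnePoint.infty
  · obtain ⟨g, hg, hg0, hgσ⟩ := hσ.infinite B hB hinf
    have hgB : g B = 0 := by
      have := hgσ.self_of_nhds
      simp only [hinf] at this
      exact (OnePoint.coe_injective this).symm
    have heq : ∀ᶠ s in 𝓝[<] B, γ (τ s) ≠ 0 ∧ (γ (τ s))⁻¹ = g s := by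
      filter_upwards [hev, mem_nhdsWithin_of_mem_nhds hgσ] with s hs hs'
      rw [hστ s hs] at hs'
      exact sphereInv_coe_eq_coe hs'
    have hc : deriv g B / (‖deriv g B‖ : ℂ) ≠ 0 := div_ne_zero hg0 (by simpa using hg0)
    -- With `g = 1 / γ`, the number `γ / ‖γ‖` is the reciprocal of `g / ‖g‖`.
    refine ⟨(-(deriv g B / (‖deriv g B‖ : ℂ)))⁻¹, inv_ne_zero (neg_ne_zero.2 hc), Or.inr ⟨?_, ?_⟩⟩
    · refine htr (G := fun t => ‖γ t‖) ?_
      have h1 : Tendsto g (𝓝[<] B) (𝓝 0) := by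
        rw [← hgB]
        exact hg.continuousAt.tendsto.mono_left nhdsWithin_le_nhds
      have h2 : Tendsto (fun s => ‖g s‖) (𝓝[<] B) (𝓝[>] 0) := by
        refine tendsto_nhdsWithin_iff.2 ⟨by simpa using h1.norm, ?_⟩
        filter_upwards [heq] with s hs
        rw [← hs.2]
        simpa using hs.1
      refine (tendsto_inv_nhdsGT_zero.comp h2).congr' ?_
      filter_upwards [heq] with s hs
      simp [← hs.2]
    · refine htr (G := fun t => γ t / (‖γ t‖ : ℂ)) ?_
      refine ((hg.differentiableAt.hasDerivAt.tendsto_direction_left hg0).inv₀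
        (neg_ne_zero.2 hc)).congr' ?_
      filter_upwards [heq] with s hs
      simp [hgB, ← hs.2, div_eq_mul_inv, mul_comm]
  · obtain ⟨g, hg, hg0, hgσ⟩ := hσ.finite B hB hinf
    have heq : ∀ᶠ s in 𝓝[<] B, g s = γ (τ s) := by
      filter_upwards [hev, mem_nhdsWithin_of_mem_nhds hgσ] with s hs hs'
      rw [hστ s hs] at hs'
      exact (OnePoint.coe_injective hs').symm
    have hc : deriv g B / (‖deriv g B‖ : ℂ) ≠ 0 := div_ne_zero hg0 (by simpa using hg0)
    refine ⟨-(deriv g B / (‖deriv g B‖ : ℂ)), neg_ne_zero.2 hc, Or.inl ⟨g B, htr ?_, ?_⟩⟩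
    · exact (hg.continuousAt.tendsto.mono_left nhdsWithin_le_nhds).congr' heq
    · refine htr (G := fun t => (γ t - g B) / (‖γ t - g B‖ : ℂ)) ?_
      refine (hg.differentiableAt.hasDerivAt.tendsto_direction_left hg0).congr' ?_
      filter_upwards [heq] with s hs
      rw [hs]

theorem HasTerminalExtension.exists_tendsto {γ : ℝ → ℂ}
    (h : HasTerminalExtension ⊥ ⊤ fun t => (γ t : RSphere)) :
    ∃ w : RSphere, Tendsto (fun t => (γ t : RSphere)) atTop (𝓝 w) := by
  obtain ⟨e, -, ⟨w, hw, -⟩ | ⟨hw, -⟩⟩ := h.exists_direction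
  · exact ⟨w, tendsto_coe_coe_iff.2 hw⟩
  · exact ⟨OnePoint.infty, tendsto_coe_infty_iff.2 hw⟩

/-! ### Rotating directions and end functions -/

theorem not_tendsto_exp_mul_I (e : ℂ) :
    ¬ Tendsto (fun t : ℝ => Complex.exp (t * Complex.I)) atTop (𝓝 e) := by
  intro h
  have hn : Tendsto (fun n : ℕ => (n : ℝ) * (2 * Real.pi)) atTop atTop :=
    tendsto_natCast_atTop_atTop.atTop_mul_const (by positivity)
  have h1 := h.comp hn
  have h2 := h.comp (tendsto_atTop_add_const_right _ Real.pi hn)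
  have e1 : ∀ n : ℕ, Complex.exp (((n * (2 * Real.pi) : ℝ) : ℂ) * Complex.I) = 1 := fun n => by
    rw [← Complex.exp_nat_mul_two_pi_mul_I n]; congr 1; push_cast; ring
  have e2 : ∀ n : ℕ,
      Complex.exp (((n * (2 * Real.pi) + Real.pi : ℝ) : ℂ) * Complex.I) = -1 := fun n => by
    rw [Complex.ofReal_add, add_mul, Complex.exp_add, e1, Complex.exp_pi_mul_I, one_mul]
  have h1' : Tendsto (fun _ : ℕ => (1 : ℂ)) atTop (𝓝 e) := h1.congr e1
  have h2' : Tendsto (fun _ : ℕ => (-1 : ℂ)) atTop (𝓝 e) := h2.congr e2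
  have := (tendsto_nhds_unique tendsto_const_nhds h1').trans
    (tendsto_nhds_unique tendsto_const_nhds h2').symm
  norm_num at this

/-- A function asymptotic to one whose direction rotates has no limiting direction. -/
theorem not_tendsto_direction {δ E : ℝ → ℂ} {r : ℝ → ℝ}
    (hE : ∀ᶠ t : ℝ in atTop, 0 < r t ∧ E t = r t * Complex.exp (t * Complex.I))
    (hδ : Tendsto (fun t => δ t / E t) atTop (𝓝 1)) (e : ℂ) :
    ¬ Tendsto (fun t => δ t / (‖δ t‖ : ℂ)) atTop (𝓝 e) := by
  intro h
  -- Dividing the direction of `δ` by that of `δ / E` leaves the direction of `E`, namely `exp (i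
  -- t)`.
  have h1 : Tendsto (fun t => (δ t / E t) / (‖δ t / E t‖ : ℂ)) atTop (𝓝 1) := by
    have := hδ.div ((Complex.continuous_ofReal.tendsto _).comp hδ.norm) (by simp)
    rw [norm_one, Complex.ofReal_one, div_one] at this
    exact this
  have h2 := h.div h1 one_ne_zero
  refine not_tendsto_exp_mul_I _ (h2.congr' ?_)
  filter_upwards [hE, hδ.eventually_ne one_ne_zero] with t ht hne
  have hr : (r t : ℂ) ≠ 0 := by exact_mod_cast ht.1.ne'
  have hδ0 : δ t ≠ 0 := by rintro h0; simp [h0] at hne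
  have hδ0' : (‖δ t‖ : ℂ) ≠ 0 := by simpa using hδ0
  have hn : ‖E t‖ = r t := by
    rw [ht.2, norm_mul, Complex.norm_exp_ofReal_mul_I, Complex.norm_real,
      Real.norm_of_nonneg ht.1.le, mul_one]
  simp only [Pi.div_apply]
  rw [norm_div, hn, ht.2]
  have hx := Complex.exp_ne_zero (t * Complex.I)
  push_cast
  field_simp

/-- The entire function `A` prescribes, up to exponentially small errors, the behaviour at `+∞`
of curves which have terminal cluster set `K` and no terminal extension. -/
structure IsEndFunction (K : Set RSphere) (A : ℂ → ℂ) : Prop where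
  differentiable : Differentiable ℂ A
  growth : ∃ C, ∀ t : ℝ, ‖A t‖ ≤ C * Real.exp (|t| / 4)
  terminal : ∀ γ : ℝ → ℂ, Tendsto (fun t => Real.exp (t / 2) * ‖γ t - A t‖) atTop (𝓝 0) →
    terminalClusterSet ⊥ ⊤ (fun t => (γ t : RSphere)) = K ∧
      ¬ HasTerminalExtension ⊥ ⊤ fun t => (γ t : RSphere)

theorem tendsto_sub_div_zero {γ A E : ℝ → ℂ}
    (h : Tendsto (fun t => Real.exp (t / 2) * ‖γ t - A t‖) atTop (𝓝 0))
    (hE : ∀ᶠ t in atTop, Real.exp (-(t / 2)) ≤ ‖E t‖) :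
    Tendsto (fun t => (γ t - A t) / E t) atTop (𝓝 0) := by
  rw [tendsto_zero_iff_norm_tendsto_zero]
  refine squeeze_zero' (Eventually.of_forall fun _ => norm_nonneg _) ?_ h
  filter_upwards [hE] with t ht
  rw [norm_div, div_eq_mul_inv, mul_comm]
  refine mul_le_mul_of_nonneg_right ?_ (norm_nonneg _)
  have := inv_anti₀ (Real.exp_pos _) ht
  rwa [Real.exp_neg, inv_inv] at this

theorem tendsto_sub_zero {γ A : ℝ → ℂ}
    (h : Tendsto (fun t => Real.exp (t / 2) * ‖γ t - A t‖) atTop (𝓝 0)) :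
    Tendsto (fun t => γ t - A t) atTop (𝓝 0) := by
  have := tendsto_sub_div_zero (E := fun _ => 1) h (by
    filter_upwards [eventually_ge_atTop 0] with t ht
    rw [norm_one, Real.exp_le_one_iff]
    linarith)
  simpa using this

/-- A spiral into `p` of radius `exp (-t / 4)`: it shrinks slowly enough to dominate the admitted
errors `o(exp (-t / 2))`, so the perturbed curve rotates too. -/
theorem isEndFunction_singleton_coe (p : ℂ) :
    IsEndFunction {(p : RSphere)} fun z => p + Complex.exp ((-1 / 4 + Complex.I) * z) := by
  have hexp : ∀ t : ℝ, Complex.exp ((-1 / 4 + Complex.I) * t) =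
      (Real.exp (-(t / 4)) : ℝ) * Complex.exp (t * Complex.I) := fun t => by
    rw [Complex.ofReal_exp, ← Complex.exp_add]
    congr 1
    push_cast
    ring
  have hnorm : ∀ t : ℝ, ‖Complex.exp ((-1 / 4 + Complex.I) * t)‖ = Real.exp (-(t / 4)) :=
    fun t => by
      rw [hexp, norm_mul, Complex.norm_exp_ofReal_mul_I, Complex.norm_real, mul_one,
        Real.norm_of_nonneg (Real.exp_pos _).le]
  refine ⟨by fun_prop, ⟨‖p‖ + 1, fun t => ?_⟩, fun γ hγ => ?_⟩
  · refine (norm_add_le _ _).trans ?_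
    rw [hnorm, add_mul, one_mul]
    refine add_le_add (le_mul_of_one_le_right (norm_nonneg _) (Real.one_le_exp (by positivity)))
      (Real.exp_le_exp.2 ?_)
    linarith [neg_abs_le t]
  · have hE0 : Tendsto (fun t : ℝ => Complex.exp ((-1 / 4 + Complex.I) * t)) atTop (𝓝 0) := by
      rw [tendsto_zero_iff_norm_tendsto_zero]
      simp only [hnorm]
      exact Real.tendsto_exp_neg_atTop_nhds_zero.comp (tendsto_id.atTop_div_const (by norm_num))
    have hp : Tendsto γ atTop (𝓝 p) := by
      have := ((tendsto_sub_zero hγ).add hE0).const_add p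
      rw [add_zero, add_zero] at this
      exact this.congr fun t => by ring
    refine ⟨terminalClusterSet_eq_singleton (tendsto_coe_coe_iff.2 hp), fun hext => ?_⟩
    obtain ⟨e, -, ⟨w, hw, hdir⟩ | ⟨hw, -⟩⟩ := hext.exists_direction
    · obtain rfl := tendsto_nhds_unique hw hp
      refine not_tendsto_direction (r := fun t => Real.exp (-(t / 4)))
        (Eventually.of_forall fun t => ⟨Real.exp_pos _, hexp t⟩) ?_ e hdir
      have h1 := (tendsto_sub_div_zero
        (E := fun t : ℝ => Complex.exp ((-1 / 4 + Complex.I) * t)) hγ (by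
          filter_upwards [eventually_ge_atTop 0] with t ht
          rw [hnorm]
          exact Real.exp_le_exp.2 (by linarith))).add_const 1
      rw [zero_add] at h1
      refine h1.congr fun t => ?_
      have := Complex.exp_ne_zero ((-1 / 4 + Complex.I) * t)
      field_simp
      ring
    · exact not_tendsto_nhds_of_tendsto_atTop hw _ hp.norm

/-- An outward spiral: the modulus tends to infinity while the argument keeps turning. -/
theorem isEndFunction_singleton_infty :
    IsEndFunction {OnePoint.infty} fun z => z * Complex.exp (z * Complex.I) := by
  have hnorm : ∀ t : ℝ, ‖(t : ℂ) * Complex.exp (t * Complex.I)‖ = |t| := fun t => by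
    rw [norm_mul, Complex.norm_exp_ofReal_mul_I, Complex.norm_real, mul_one, Real.norm_eq_abs]
  refine ⟨by fun_prop, ⟨4, fun t => ?_⟩, fun γ hγ => ?_⟩
  · rw [hnorm]
    linarith [Real.add_one_le_exp (|t| / 4)]
  · have hlim : Tendsto (fun t => (γ t : RSphere)) atTop (𝓝 OnePoint.infty) := by
      refine tendsto_coe_of_tendsto_sub (tendsto_coe_infty_iff.2 ?_) (tendsto_sub_zero hγ)
      simp only [hnorm]
      exact tendsto_abs_atTop_atTop
    refine ⟨terminalClusterSet_eq_singleton hlim, fun hext => ?_⟩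
    obtain ⟨e, -, ⟨w, hw, -⟩ | ⟨-, hdir⟩⟩ := hext.exists_direction
    · exact OnePoint.infty_ne_coe w (tendsto_nhds_unique hlim (tendsto_coe_coe_iff.2 hw))
    · refine not_tendsto_direction (r := fun t => t)
        (E := fun t : ℝ => (t : ℂ) * Complex.exp (t * Complex.I))
        ((eventually_gt_atTop 0).mono fun t ht => ⟨ht, rfl⟩) ?_ e hdir
      have h1 := (tendsto_sub_div_zero
        (E := fun t : ℝ => (t : ℂ) * Complex.exp (t * Complex.I)) hγ (by
          filter_upwards [eventually_ge_atTop 1] with t ht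
          rw [hnorm]
          exact (Real.exp_le_one_iff.2 (by linarith)).trans
            (ht.trans (le_abs_self t)))).add_const 1
      rw [zero_add] at h1
      refine h1.congr' ?_
      filter_upwards [eventually_gt_atTop 0] with t ht
      have := Complex.exp_ne_zero (t * Complex.I)
      have ht' : (t : ℂ) ≠ 0 := by exact_mod_cast ht.ne'
      field_simp
      ring

/-- `33 = 1 + 32`, the `32` from the quadratic term `(|t| / 4) ^ 2 / 2` of the exponential series.
-/
theorem one_add_sq_le_exp (t : ℝ) : 1 + t ^ 2 ≤ 33 * Real.exp (|t| / 4) := by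
  have h1 : 1 ≤ Real.exp (|t| / 4) := Real.one_le_exp (by positivity)
  have h2 := Real.pow_div_factorial_le_exp (|t| / 4) (by positivity) 2
  rw [div_pow, sq_abs] at h2
  norm_num [Nat.factorial] at h2
  linarith

/-- Every continuum of the sphere has an end function. -/
theorem IsContinuum.exists_isEndFunction {K : Set RSphere} (hK : IsContinuum K) :
    ∃ A, IsEndFunction K A := by
  by_cases hs : ∃ w, K = {w}
  · obtain ⟨w, rfl⟩ := hs
    induction w using OnePoint.rec with
    | infty => exact ⟨_, isEndFunction_singleton_infty⟩
    | coe p => exact ⟨_, isEndFunction_singleton_coe p⟩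
  · obtain ⟨q, hq, hqK⟩ := hK.exists_seq
    obtain ⟨A, hA, ⟨C, hC⟩, k, hk, ⟨s, hs', hks⟩, hAk⟩ := exists_entire_tracing hq
    have hC0 : 0 ≤ C := by simpa using (norm_nonneg _).trans (hC 0)
    refine ⟨A, hA, ⟨C * 33, fun t => (hC t).trans ?_⟩, fun γ hγ => ?_⟩
    · rw [mul_assoc]
      exact mul_le_mul_of_nonneg_left (one_add_sq_le_exp t) hC0
    · have hγq : Tendsto (fun t => γ t - q (k t)) atTop (𝓝 0) := by
        simpa using (tendsto_sub_zero hγ).add hAk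
      have hcl : terminalClusterSet ⊥ ⊤ (fun t => (γ t : RSphere)) = K := by
        ext w
        rw [mem_terminalClusterSet_bot_top, ← hqK]
        constructor
        · rintro ⟨t, ht, hw⟩
          have h1 : Tendsto (fun n => (q (k (t n)) : RSphere)) atTop (𝓝 w) := by
            refine tendsto_coe_of_tendsto_sub hw ?_
            simpa using (hγq.comp ht).neg
          exact MapClusterPt.of_comp (hk.comp ht) h1.mapClusterPt
        · intro hw
          obtain ⟨φ, hφ, hlim⟩ := hw.tendsto_subseq
          have hsφ := hs'.comp hφ.tendsto_atTop
          refine ⟨s ∘ φ, hsφ, tendsto_coe_of_tendsto_sub hlim ?_⟩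
          simpa [Function.comp_def, hks] using hγq.comp hsφ
      refine ⟨hcl, fun hext => hs ?_⟩
      obtain ⟨w, hw⟩ := hext.exists_tendsto
      exact ⟨w, hcl.symm.trans (terminalClusterSet_eq_singleton hw)⟩

/-! ### Time reversal -/

theorem neg_mem_realIoo {a b : EReal} {t : ℝ} : -t ∈ realIoo a b ↔ t ∈ realIoo (-b) (-a) := by
  simp only [realIoo, Set.mem_ofPred_eq, EReal.coe_neg]
  rw [EReal.lt_neg_comm, EReal.neg_lt_comm, and_comm]

theorem RegularAnalyticAt.comp_neg {γ : ℝ → RSphere} {t : ℝ} (h : RegularAnalyticAt γ (-t)) :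
    RegularAnalyticAt (fun s => γ (-s)) t := by
  obtain ⟨g, hg, hg0, hγ⟩ := h
  exact ⟨fun s => g (-s), hg.comp_of_eq (f := fun s : ℝ => -s) (by fun_prop) rfl,
    by rw [deriv_comp_neg]; exact neg_ne_zero.2 hg0, (continuous_neg.tendsto t).eventually hγ⟩

theorem IsAnalyticCurve.comp_neg {a b : EReal} {γ : ℝ → RSphere} (h : IsAnalyticCurve a b γ) :
    IsAnalyticCurve (-b) (-a) fun t => γ (-t) where
  lt := EReal.neg_lt_neg_iff.2 h.lt
  finite _ ht ht' := (h.finite _ (neg_mem_realIoo.2 ht) ht').comp_neg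
  infinite _ ht ht' := (h.infinite _ (neg_mem_realIoo.2 ht) ht').comp_neg

theorem IsAnalyticParamChange.comp_neg {c d a b : EReal} {τ : ℝ → ℝ}
    (h : IsAnalyticParamChange c d a b τ) :
    IsAnalyticParamChange (-d) (-c) (-b) (-a) fun s => -τ (-s) where
  analytic s hs :=
    ((h.analytic _ (neg_mem_realIoo.2 hs)).comp_of_eq (f := fun s : ℝ => -s)
      (by fun_prop) rfl).neg
  deriv_pos s hs := by
    rw [deriv.fun_neg, deriv_comp_neg, neg_neg]
    exact h.deriv_pos _ (neg_mem_realIoo.2 hs)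
  bijOn := by
    refine ⟨fun s hs => ?_, fun s hs s' hs' hss => ?_, fun t ht => ?_⟩
    · rw [← neg_mem_realIoo, neg_neg]
      exact h.bijOn.mapsTo (neg_mem_realIoo.2 hs)
    · exact neg_injective (h.bijOn.injOn (neg_mem_realIoo.2 hs) (neg_mem_realIoo.2 hs')
        (neg_injective hss))
    · obtain ⟨s, hs, hst⟩ := h.bijOn.surjOn (neg_mem_realIoo.2 ht)
      exact ⟨-s, by rw [← neg_mem_realIoo, neg_neg]; exact hs, by simp [hst]⟩

theorem HasInitialExtension.comp_neg {a b : EReal} {γ : ℝ → RSphere}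
    (h : HasInitialExtension a b γ) : HasTerminalExtension (-b) (-a) fun t => γ (-t) := by
  obtain ⟨L, R, σ, A, τ, hσ, hA, hτ, hστ⟩ := h
  refine ⟨-R, -L, fun t => σ (-t), -A, fun s => -τ (-s), hσ.comp_neg, ?_, ?_, fun s hs => ?_⟩
  · rw [← neg_mem_realIoo, neg_neg]
    exact hA
  · exact hτ.comp_neg
  · rw [EReal.coe_neg, ← neg_mem_realIoo] at hs
    simp [hστ _ hs]

theorem initialClusterSet_bot_top (γ : ℝ → RSphere) :
    initialClusterSet ⊥ ⊤ γ = terminalClusterSet ⊥ ⊤ fun t => γ (-t) := by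
  ext w
  rw [mem_terminalClusterSet_bot_top]
  simp only [initialClusterSet, curveClusterSet, realIoo_bot_top, Set.mem_univ, implies_true,
    true_and, Set.mem_ofPred_eq, EReal.tendsto_coe_nhds_bot_iff]
  constructor
  · rintro ⟨t, ht, hw⟩
    exact ⟨fun n => -t n, tendsto_neg_atBot_atTop.comp ht, by simpa using hw⟩
  · rintro ⟨t, ht, hw⟩
    exact ⟨fun n => -t n, tendsto_neg_atTop_atBot.comp ht, hw⟩

/-! ### Regularity of the curve -/

theorem isAnalyticCurve_bot_top_of_entire {f : ℂ → ℂ} (hf : Differentiable ℂ f)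
    (h0 : ∀ t : ℝ, deriv f t ≠ 0) :
    IsAnalyticCurve ⊥ ⊤ fun t : ℝ => ((f t : ℂ) : RSphere) where
  lt := bot_lt_top
  finite t _ _ := by
    refine ⟨fun t : ℝ => f t, ?_, ?_, Eventually.of_forall fun _ => rfl⟩
    · exact ((hf.analyticAt t).restrictScalars (𝕜 := ℝ)).comp_of_eq
        (f := fun t : ℝ => (t : ℂ)) (Complex.ofRealCLM.analyticAt t) rfl
    · rw [(hf t).hasDerivAt.comp_ofReal.deriv]
      exact h0 t
  infinite t _ h := absurd h (OnePoint.coe_ne_infty _)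

/-- Adding a suitable multiple of a function with nowhere vanishing derivative makes the derivative
of an entire function nonzero on the real line. -/
theorem exists_const_deriv_ne_zero {F h : ℂ → ℂ} (hF : Differentiable ℂ F)
    (hh : Differentiable ℂ h) (h0 : ∀ t : ℝ, deriv h t ≠ 0) :
    ∃ c : ℂ, ∀ t : ℝ, deriv (fun z => F z + c * h z) t ≠ 0 := by
  have hcd : ∀ {G : ℂ → ℂ}, Differentiable ℂ G → ContDiff ℝ 1 fun t : ℝ => deriv G t :=
    fun hG => ((hG.contDiff (n := 2)).deriv' (n := 1)).restrict_scalars ℝ |>.comp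
      Complex.ofRealCLM.contDiff
  have hφ : ContDiff ℝ 1 fun t : ℝ => -deriv F t * (deriv h t)⁻¹ :=
    (hcd hF).neg.mul ((hcd hh).inv h0)
  -- A zero of `F' + c h'` on the line means that `c` is a value of `-F' / h'`, and a `C¹` image of
  -- the line cannot fill the plane.
  obtain ⟨c, hc⟩ := (hφ.dense_compl_range_of_finrank_lt_finrank (by simp)).nonempty
  refine ⟨c, fun t ht => hc ⟨t, ?_⟩⟩
  rw [deriv_fun_add (hF _) ((hh _).const_mul c), deriv_const_mul _ (hh _)] at ht
  simp only
  rw [← div_eq_mul_inv, div_eq_iff (h0 t)]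
  linear_combination -ht

/-! ### Gluing the two ends -/

/-- An entire function equal to a smoothed unit step on the real line. -/
noncomputable def smoothStep (z : ℂ) : ℂ := Complex.exp (-Complex.exp (-z))

theorem differentiable_smoothStep : Differentiable ℂ smoothStep := by
  unfold smoothStep
  fun_prop

theorem smoothStep_ofReal (t : ℝ) : smoothStep t = (Real.exp (-Real.exp (-t)) : ℝ) := by
  simp [smoothStep]

theorem norm_smoothStep_sub_one_le (t : ℝ) : ‖smoothStep t - 1‖ ≤ Real.exp (-t) := by
  rw [smoothStep_ofReal, ← Complex.ofReal_one, ← Complex.ofReal_sub, Complex.norm_real,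
    Real.norm_of_nonpos (sub_nonpos.2 (Real.exp_le_one_iff.2 (neg_nonpos.2 (Real.exp_pos _).le)))]
  linarith [Real.add_one_le_exp (-Real.exp (-t))]

theorem norm_smoothStep_neg_le (t : ℝ) : ‖smoothStep (-t)‖ ≤ Real.exp (-t) := by
  have := smoothStep_ofReal (-t)
  rw [neg_neg, Complex.ofReal_neg] at this
  rw [this, Complex.norm_real, Real.norm_of_nonneg (Real.exp_pos _).le]
  exact Real.exp_le_exp.2 (by linarith [Real.add_one_le_exp t])

/-- The step factors err by at most `exp (-t)`, and `exp (t / 2) * exp (-t) * exp (t / 4) = exp (-t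
/ 4)` still tends to zero. The two-sided growth bound controls the end function that is being
switched off. -/
theorem tendsto_blend {x y η : ℝ → ℂ} {C D M : ℝ}
    (hx : ∀ t, ‖x t‖ ≤ C * Real.exp (|t| / 4)) (hy : ∀ t, ‖y t‖ ≤ D * Real.exp (|t| / 4))
    (hη : ∀ t, 1 ≤ t → ‖η t‖ ≤ M * Real.exp (-t)) :
    Tendsto (fun t : ℝ => Real.exp (t / 2) *
      ‖smoothStep t * x t + smoothStep (-t) * y t + η t - x t‖) atTop (𝓝 0) := by
  have hlim : Tendsto (fun t : ℝ => (C + D + M) * Real.exp (-(t / 4))) atTop (𝓝 0) := by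
    have := (Real.tendsto_exp_neg_atTop_nhds_zero.comp
      (tendsto_id.atTop_div_const (show (0 : ℝ) < 4 by norm_num))).const_mul (C + D + M)
    rwa [mul_zero] at this
  refine squeeze_zero' (Eventually.of_forall fun _ => by positivity) ?_ hlim
  filter_upwards [eventually_ge_atTop 1] with t ht
  have hx' := hx t
  have hy' := hy t
  rw [abs_of_nonneg (by linarith : 0 ≤ t)] at hx' hy'
  have hM : 0 ≤ M := by
    have := (norm_nonneg _).trans (hη 1 le_rfl)
    exact nonneg_of_mul_nonneg_left this (Real.exp_pos _)
  have h1 : ‖smoothStep t * x t + smoothStep (-t) * y t + η t - x t‖ ≤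
      Real.exp (-t) * (C * Real.exp (t / 4)) + Real.exp (-t) * (D * Real.exp (t / 4)) +
        Real.exp (-t) * (M * Real.exp (t / 4)) := by
    rw [show smoothStep t * x t + smoothStep (-t) * y t + η t - x t =
      (smoothStep t - 1) * x t + smoothStep (-t) * y t + η t by ring]
    refine norm_add₃_le.trans (add_le_add (add_le_add ?_ ?_) ?_)
    · rw [norm_mul]
      exact mul_le_mul (norm_smoothStep_sub_one_le t) hx' (norm_nonneg _) (Real.exp_pos _).le
    · rw [norm_mul]
      exact mul_le_mul (norm_smoothStep_neg_le t) hy' (norm_nonneg _) (Real.exp_pos _).le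
    · refine (hη t ht).trans ?_
      rw [mul_comm]
      exact mul_le_mul_of_nonneg_left (le_mul_of_one_le_right hM (Real.one_le_exp (by linarith)))
        (Real.exp_pos _).le
  calc _ ≤ Real.exp (t / 2) * _ := mul_le_mul_of_nonneg_left h1 (Real.exp_pos _).le
    _ = (C + D + M) * (Real.exp (t / 2) * Real.exp (-t) * Real.exp (t / 4)) := by ring
    _ = _ := by
      rw [← Real.exp_add, ← Real.exp_add]
      congr 2
      ring

theorem norm_exp_neg_sq_add (t : ℝ) :
    ‖Complex.exp (-(t : ℂ) ^ 2 + Complex.I * t)‖ = Real.exp (-t ^ 2) := by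
  rw [Complex.norm_exp]
  congr 1
  simp [← Complex.ofReal_pow]

theorem theorem1 (Kminus Kplus : Set RSphere)
    (hminus : IsContinuum Kminus) (hplus : IsContinuum Kplus) :
    ∃ γ : ℝ → ℂ,
      (∃ f : ℂ → ℂ, Differentiable ℂ f ∧ ∀ t : ℝ, γ t = f (t : ℂ)) ∧
      IsAnalyticCurve ⊥ ⊤ (fun t => ((γ t : ℂ) : RSphere)) ∧
      initialClusterSet ⊥ ⊤ (fun t => ((γ t : ℂ) : RSphere)) = Kminus ∧
      terminalClusterSet ⊥ ⊤ (fun t => ((γ t : ℂ) : RSphere)) = Kplus ∧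
      IsAnalyticallyMaximal ⊥ ⊤ (fun t => ((γ t : ℂ) : RSphere)) := by
  obtain ⟨A, hA⟩ := hplus.exists_isEndFunction
  obtain ⟨B, hB⟩ := hminus.exists_isEndFunction
  obtain ⟨C, hC⟩ := hA.growth
  obtain ⟨D, hD⟩ := hB.growth
  let F : ℂ → ℂ := fun z => smoothStep z * A z + smoothStep (-z) * B (-z)
  -- The Gaussian makes `h` negligible at both ends. The term `i z` does not change its modulus on
  -- the real line but gives `h' / h = -2 t + i`, which has no real zero.
  let h : ℂ → ℂ := fun z => Complex.exp (-z ^ 2 + Complex.I * z)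
  have hF : Differentiable ℂ F :=
    (differentiable_smoothStep.mul hA.differentiable).add
      ((differentiable_smoothStep.comp differentiable_neg).mul
        (hB.differentiable.comp differentiable_neg))
  have hh : Differentiable ℂ h := by fun_prop
  have hh0 : ∀ t : ℝ, deriv h t ≠ 0 := by
    intro t
    have hd : HasDerivAt h (h t * (-(2 * t) + Complex.I)) t := by
      have h1 : HasDerivAt (fun z : ℂ => -z ^ 2 + Complex.I * z) (-(2 * t) + Complex.I) t := by
        simpa using ((hasDerivAt_pow 2 (t : ℂ)).fun_neg).fun_add
          ((hasDerivAt_id (t : ℂ)).const_mul Complex.I)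
      exact h1.cexp
    rw [hd.deriv]
    refine mul_ne_zero (Complex.exp_ne_zero _) fun h2 => ?_
    simpa using congrArg Complex.im h2
  obtain ⟨c, hc⟩ := exists_const_deriv_ne_zero hF hh hh0
  have hη : ∀ t : ℝ, 1 ≤ t → ‖c * h t‖ ≤ ‖c‖ * Real.exp (-t) := fun t ht => by
    rw [norm_mul, norm_exp_neg_sq_add]
    exact mul_le_mul_of_nonneg_left (Real.exp_le_exp.2 (by nlinarith)) (norm_nonneg _)
  have hη' : ∀ t : ℝ, 1 ≤ t → ‖c * h (-t)‖ ≤ ‖c‖ * Real.exp (-t) := fun t ht => by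
    rw [norm_mul, ← Complex.ofReal_neg, norm_exp_neg_sq_add, neg_sq]
    exact mul_le_mul_of_nonneg_left (Real.exp_le_exp.2 (by nlinarith)) (norm_nonneg _)
  have hC' : ∀ t : ℝ, ‖A (-t)‖ ≤ C * Real.exp (|t| / 4) := fun t => by simpa using hC (-t)
  have hD' : ∀ t : ℝ, ‖B (-t)‖ ≤ D * Real.exp (|t| / 4) := fun t => by simpa using hD (-t)
  have hplus' := hA.terminal (fun t => F t + c * h t) (tendsto_blend hC hD' hη)
  have hminus' := hB.terminal (fun t => F ((-t : ℝ) : ℂ) + c * h ((-t : ℝ) : ℂ)) <| by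
    refine (tendsto_blend hD hC' hη').congr fun t => ?_
    simp only [F, Complex.ofReal_neg, neg_neg]
    rw [add_comm (smoothStep (-t) * A (-t))]
  refine ⟨fun t => F t + c * h t, ⟨fun z => F z + c * h z, hF.add (hh.const_mul c), fun _ => rfl⟩,
    isAnalyticCurve_bot_top_of_entire (hF.add (hh.const_mul c)) hc, ?_, hplus'.1, fun hext => ?_,
    hplus'.2⟩
  · rw [initialClusterSet_bot_top]
    exact hminus'.1
  · exact hminus'.2 hext.comp_neg
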